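/- **Setting (PIR with private coded side information, Model I).** Let $1\le M\le K-1$ be integers. Let $\mathbb{F}_q$ be a finite field, $\mathbb{F}_{q^l}$ ($l\ge 1$) an extension field, and $L=l\log_2 q$. A server stores $K$ messages $X_1,\dots,X_K$, independent and uniformly distributed over $\mathbb{F}_{q^l}$. Let $S$ be a uniformly random $M$-subset of $\{1,\dots,K\}$, let $C=(c_i)_{i\in S}$ be uniformly distributed over the sequences of $M$ elements of $\mathbb{F}_q^\times$, independently of $S$, and, given $(S,C)$, let $W$ be uniformly distributed over $\{1,\dots,K\}\setminus S$; $(W,S,C)$ is independent of the messages. A user knows $(W,S,C)$ and the coded side information $Y^{[S,C]}=\sum_{i\in S}c_iX_i$, and wants $X_W$. A *protocol* consists of a discrete random query $Q$, whose law depends on $(W,S,C)$ only and which, given $(W,S,C)$, is independent of the messages, and of an answer $A$, which is a deterministic function of $Q$ and $(X_1,\dots,X_K)$. It is a *PIR-PCSI--I protocol* if it satisfies $(W,S)$-privacy, i.e. $\mathbb{P}(W=w,S=s\mid Q=x)=\mathbb{P}(W=w,S=s)$ for all $w,s$ and all $x$ with $\mathbb{P}(Q=x)>0$, and recoverability, i.e.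 $H(X_W\mid A,Q,Y^{[S,C]},W,S,C)=0$. Its rate is $L/H(A)$ (entropies in bits). It is *scalar-linear* if, for each query, the answer is a list of linear combinations of $X_1,\dots,X_K$ with coefficients in $\mathbb{F}_q$. The *capacity* (respectively, *scalar-linear capacity*) is the supremum of the rates of all PIR-PCSI--I protocols (respectively, of all scalar-linear ones) over all prime powers $q$ and all $l\ge 1$. **Theorem.** For all integers $1\le M\le K-1$, the capacity and the scalar-linear capacity of the PIR-PCSI--I setting with $K$ messages and side information support size $M$ are both equal to $(K-M)^{-1}$. -/

import Mathlib

open scoped ENNReal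

namespace PIR

noncomputable section

/-- Shannon entropy, in bits, of a discrete distribution:
`H(p) = ∑ₐ -p(a) log₂ p(a)`, with values in `[0, ∞]`. -/
def entropy {α : Type} (p : PMF α) : ℝ≥0∞ :=
  ∑' a, ENNReal.ofReal (-((p a).toReal * Real.logb 2 (p a).toReal))

/-- Conditional Shannon entropy, in bits, of the discrete random variable `f` given the discrete
random variable `g`, both defined on the discrete probability space `(Ω, p)`:
`H(f | g) = ∑ P(f = a, g = b) log₂ (P(g = b) / P(f = a, g = b))`, with values in `[0, ∞]`. -/
def condEntropy {Ω α β : Type} (p : PMF Ω) (f : Ω → α) (g : Ω → β) : ℝ≥0∞ :=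
  ∑' b, ∑' a, ENNReal.ofReal
    ((p.map (fun ω => (f ω, g ω)) (a, b)).toReal *
      Real.logb 2 ((p.map g b).toReal / (p.map (fun ω => (f ω, g ω)) (a, b)).toReal))

/-- The `M`-subsets of the set of the `K` message indices. -/
abbrev Supp (K M : ℕ) : Type := {S : Finset (Fin K) // S.card = M}

/-- The sequences of `M` nonzero elements of the base field. -/
abbrev Coeff (M : ℕ) (F : Type) [Field F] : Type := Fin M → Fˣ

/-- The coded side information `Y^[S,C] = ∑_{i ∈ S} c_i X_i`; the `k`-th entry of `C` is the
coefficient of the message whose index is the `k`-th smallest element of `S`. -/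
def sideInfo {K M : ℕ} {F E : Type} [Field F] [Field E] [Algebra F E]
    (S : Supp K M) (C : Coeff M F) (X : Fin K → E) : E :=
  ∑ k : Fin M, (C k : F) • X (S.1.orderEmbOfFin S.2 k)

theorem nonempty_supp {K M : ℕ} (h : M < K) : Nonempty (Supp K M) := by
  obtain ⟨S, -, hS⟩ := Finset.exists_subset_card_eq
    (s := (Finset.univ : Finset (Fin K))) (n := M) (by simpa using h.le)
  exact ⟨⟨S, hS⟩⟩

theorem nonempty_compl {K M : ℕ} (h : M < K) (S : Supp K M) : (S.1ᶜ).Nonempty := by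
  rw [← Finset.card_pos, Finset.card_compl, Fintype.card_fin, S.2]
  omega

/-- A (query, answer) protocol for `K` messages in `E` and side information of support size `M` with
coefficients in `F`. The query is a stochastic function of `(W, S, C)`, given by its conditional
law, and the answer is a deterministic function of the query and the messages. (The server also
knows that `W ∉ S`, which is the same for all outcomes and hence is no further argument.) -/
structure Protocol (K M : ℕ) (F E : Type) [Field F] (𝒬 𝒜 : Type) where
  query : Fin K → Supp K M → Coeff M F → PMF 𝒬
  answer : 𝒬 → (Fin K → E) → 𝒜

/-- An outcome of all the randomness: demand index, support of the side information, coefficients of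
the side information, query, messages. -/
structure Outcome (K M : ℕ) (F E : Type) [Field F] (𝒬 : Type) where
  W : Fin K
  S : Supp K M
  C : Coeff M F
  Q : 𝒬
  X : Fin K → E

namespace Protocol

variable {K M : ℕ} {F E : Type} [Field F] [Fintype F] [DecidableEq F] [Field E] [Fintype E]
  {𝒬 𝒜 : Type}

/-- The joint law when the demand is outside the support: `S` and `C` are uniform and independent;
given these, `W` is uniform on the complement of `S`; given these, `Q` is drawn by the protocol; and
the messages are i.i.d. uniform on `E`, independently of everything else. -/
def law (h : M < K) (P : Protocol K M F E 𝒬 𝒜) : PMF (Outcome K M F E 𝒬) :=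
  haveI := nonempty_supp h
  (PMF.uniformOfFintype (Supp K M)).bind fun S =>
  (PMF.uniformOfFintype (Coeff M F)).bind fun C =>
  (PMF.uniformOfFinset (S.1ᶜ) (nonempty_compl h S)).bind fun W =>
  (P.query W S C).bind fun Q =>
  (PMF.uniformOfFintype (Fin K → E)).bind fun X =>
  PMF.pure ⟨W, S, C, Q, X⟩

/-- The demand is almost surely outside the support, so that conditioning on this event changes
nothing. -/
theorem notMem_of_mem_support_law (h : M < K) (P : Protocol K M F E 𝒬 𝒜)
    (ω : Outcome K M F E 𝒬) (hω : ω ∈ (P.law h).support) : ω.W ∉ ω.S.1 := by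
  simp only [law, PMF.mem_support_bind_iff, PMF.mem_support_pure_iff,
    PMF.mem_support_uniformOfFinset_iff, Finset.mem_compl] at hω
  obtain ⟨S, -, C, -, W, hW, Q, -, X, -, rfl⟩ := hω
  exact hW

/-- The answer `A` as a random variable. -/
def ans (P : Protocol K M F E 𝒬 𝒜) (ω : Outcome K M F E 𝒬) : 𝒜 := P.answer ω.Q ω.X

/-- `(W,S)`-privacy: `P(W = w, S = s | Q = q) = P(W = w, S = s)` for every query `q` that occurs
and all `w`, `s` (all under the law of the model, where `W ∉ S` almost surely). -/
def IsPrivate (h : M < K) (P : Protocol K M F E 𝒬 𝒜) : Prop :=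
  ∀ q : 𝒬, (P.law h).map Outcome.Q q ≠ 0 → ∀ (w : Fin K) (s : Supp K M),
    (P.law h).map (fun ω => ((ω.W, ω.S), ω.Q)) ((w, s), q) / (P.law h).map Outcome.Q q =
      (P.law h).map (fun ω => (ω.W, ω.S)) (w, s)

/-- Recoverability: `H(X_W | A, Q, Y^[S,C], W, S, C) = 0`. -/
def IsRecoverable [Algebra F E] (h : M < K) (P : Protocol K M F E 𝒬 𝒜) : Prop :=
  condEntropy (P.law h) (fun ω => ω.X ω.W)
    (fun ω => (P.ans ω, ω.Q, sideInfo ω.S ω.C ω.X, ω.W, ω.S, ω.C)) = 0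

/-- The rate `L / H(A)`, where `L = l log₂ q` with `q = |F|` and `l = [E : F]` is the entropy of a
message. -/
def rate [Algebra F E] (h : M < K) (P : Protocol K M F E 𝒬 𝒜) : ℝ≥0∞ :=
  ENNReal.ofReal (Module.finrank F E * Real.logb 2 (Fintype.card F)) /
    entropy ((P.law h).map P.ans)

/-- Scalar-linear protocols: the answer to each query is a list of linear combinations of the
messages with coefficients in `F` that depend on the query only. -/
def IsScalarLinear [Algebra F E] (P : Protocol K M F E 𝒬 (List E)) : Prop :=
  ∀ q : 𝒬, ∃ (n : ℕ) (G : Matrix (Fin n) (Fin K) F), ∀ X : Fin K → E,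
    P.answer q X = List.ofFn fun i => ∑ j, G i j • X j

end Protocol

/-- The capacity: supremum of the rates of all private and recoverable protocols, over all
finite fields `F = 𝔽_q`, all finite extensions `E = 𝔽_{q^l}` and all alphabets. -/
def capacity (K M : ℕ) (h : M < K) : ℝ≥0∞ :=
  sSup {r | ∃ (F E : Type) (_ : Field F) (_ : Fintype F) (_ : DecidableEq F) (_ : Field E)
    (_ : Fintype E) (_ : Algebra F E) (𝒬 𝒜 : Type) (P : Protocol K M F E 𝒬 𝒜),
    P.IsPrivate h ∧ P.IsRecoverable h ∧ r = P.rate h}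

/-- The scalar-linear capacity: the same supremum over the scalar-linear protocols only. -/
def scalarLinearCapacity (K M : ℕ) (h : M < K) : ℝ≥0∞ :=
  sSup {r | ∃ (F E : Type) (_ : Field F) (_ : Fintype F) (_ : DecidableEq F) (_ : Field E)
    (_ : Fintype E) (_ : Algebra F E) (𝒬 : Type) (P : Protocol K M F E 𝒬 (List E)),
    P.IsScalarLinear ∧ P.IsPrivate h ∧ P.IsRecoverable h ∧ r = P.rate h}

end

end PIR

/-! Converse: by privacy, a query that occurs is compatible with every demand `w` and support `s`
with `w ∉ s`, for some coefficients. Fix one `s`. The messages on `s` determine every coded side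
information on `s`, so together with the answer they determine every other message. Hence an answer
has at most `|E| ^ M` preimages (`card_answer_fiber_le`), no answer has probability above `|E| ^
(-(K - M))`, and min-entropy gives `H(A) ≥ (K - M) L`.

Achievability: with distinct points `x j`, ask for the `K - M` checks `∑ v j * x j ^ m * X j`. The
polynomial vanishing off `S ∪ {w}` has degree `K - M - 1`, so it combines the checks into a relation
supported on `S ∪ {w}` (`sum_locator_mul`). The multipliers `v` on `S` are chosen to make its
entries there equal `C`; elsewhere they are uniform. As `C` is uniform, so is `v`, whatever the
demand (`reedSolomon_queryLaw_eq`). -/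

namespace PIR

/-! ### Entropy bounds and vanishing conditional entropy -/

section Entropy

theorem ofReal_toReal_apply {α : Type} (p : PMF α) (a : α) :
    ENNReal.ofReal (p a).toReal = p a :=
  ENNReal.ofReal_toReal (p.apply_ne_top a)

theorem toReal_apply_le_one {α : Type} (p : PMF α) (a : α) : (p a).toReal ≤ 1 :=
  ENNReal.toReal_le_of_le_ofReal zero_le_one (by simpa using p.coe_le_one a)

/-- Shannon entropy is bounded below by min-entropy. -/
theorem logb_le_entropy {α : Type} (p : PMF α) (N : ℝ) (hN : 0 < N)
    (hp : ∀ a, (p a).toReal ≤ N⁻¹) : ENNReal.ofReal (Real.logb 2 N) ≤ entropy p := by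
  calc ENNReal.ofReal (Real.logb 2 N) = ∑' a, p a * ENNReal.ofReal (Real.logb 2 N) := by
        rw [ENNReal.tsum_mul_right, p.tsum_coe, one_mul]
    _ ≤ entropy p := by
        refine ENNReal.tsum_le_tsum fun a => ?_
        rw [← ofReal_toReal_apply p a, ← ENNReal.ofReal_mul ENNReal.toReal_nonneg,
          ENNReal.toReal_ofReal ENNReal.toReal_nonneg, ← mul_neg]
        refine ENNReal.ofReal_le_ofReal ?_
        rcases (ENNReal.toReal_nonneg (a := p a)).eq_or_lt with h0 | h0
        · simp [← h0]
        · refine mul_le_mul_of_nonneg_left ?_ h0.le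
          rw [← Real.logb_inv]
          refine Real.logb_le_logb_of_le (by norm_num) hN ?_
          rw [le_inv_comm₀ hN h0]
          exact hp a

/-- Shannon entropy is bounded above by the logarithm of the size of the support. -/
theorem entropy_le_logb_card {α : Type} (p : PMF α) (s : Finset α) (hs : ∀ a ∉ s, p a = 0) :
    entropy p ≤ ENNReal.ofReal (Real.logb 2 s.card) := by
  have hsum : ∑ a ∈ s, (p a).toReal = 1 := by
    rw [← ENNReal.toReal_sum fun a _ => p.apply_ne_top a,
      ← tsum_eq_sum (L := .unconditional α) hs, p.tsum_coe, ENNReal.toReal_one]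
  have hne : s.Nonempty := by
    rw [Finset.nonempty_iff_ne_empty]
    rintro rfl
    simp at hsum
  have hN : (0 : ℝ) < s.card := by exact_mod_cast hne.card_pos
  have h2 : 0 < Real.log 2 := Real.log_pos (by norm_num)
  -- This is `log t ≤ t - 1` at `t = 1 / (p a * N)` with `N = s.card`; the correction terms sum to
  -- zero over `s`.
  have key : ∀ a ∈ s, -((p a).toReal * Real.logb 2 (p a).toReal) ≤
      (p a).toReal * Real.logb 2 s.card + ((s.card : ℝ)⁻¹ - (p a).toReal) / Real.log 2 := by
    intro a _
    rcases (ENNReal.toReal_nonneg (a := p a)).eq_or_lt with h0 | h0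
    · rw [← h0]
      simp only [zero_mul, neg_zero, sub_zero, zero_add]
      positivity
    · have hlog := Real.log_le_sub_one_of_pos (inv_pos.2 (mul_pos h0 hN))
      rw [Real.log_inv, Real.log_mul h0.ne' hN.ne'] at hlog
      have hmul := mul_le_mul_of_nonneg_left hlog h0.le
      have hexp : (p a).toReal * (((p a).toReal * (s.card : ℝ))⁻¹ - 1) =
          (s.card : ℝ)⁻¹ - (p a).toReal := by
        field_simp
      rw [hexp] at hmul
      rw [Real.logb, Real.logb, mul_div_assoc', mul_div_assoc', ← add_div, ← neg_div]
      exact (div_le_div_iff_of_pos_right h2).2 (by linarith)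
  rw [entropy, tsum_eq_sum (s := s) fun a ha => by simp [hs a ha],
    ← ENNReal.ofReal_sum_of_nonneg fun a _ => ?_]
  · refine ENNReal.ofReal_le_ofReal ((Finset.sum_le_sum key).trans (le_of_eq ?_))
    rw [Finset.sum_add_distrib, ← Finset.sum_mul, hsum, ← Finset.sum_div,
      Finset.sum_sub_distrib, hsum, Finset.sum_const, nsmul_eq_mul, mul_inv_cancel₀ hN.ne']
    simp
  · rw [← mul_neg]
    exact mul_nonneg ENNReal.toReal_nonneg (neg_nonneg.2 (Real.logb_nonpos (by norm_num)
      ENNReal.toReal_nonneg (toReal_apply_le_one p a)))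

theorem map_apply_eq_toOuterMeasure {Ω α : Type} (p : PMF Ω) (f : Ω → α) (a : α) :
    p.map f a = p.toOuterMeasure {ω | f ω = a} := by
  rw [← PMF.toOuterMeasure_apply_singleton, PMF.toOuterMeasure_map_apply]
  rfl

/-- The conditional entropy vanishes exactly if `f` is a function of `g` on the support. -/
theorem condEntropy_eq_zero_iff {Ω α β : Type} (p : PMF Ω) (f : Ω → α) (g : Ω → β) :
    condEntropy p f g = 0 ↔ ∀ ω ∈ p.support, ∀ ω' ∈ p.support, g ω = g ω' → f ω = f ω' := by
  classical
  simp only [condEntropy, ENNReal.tsum_eq_zero, ENNReal.ofReal_eq_zero]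
  constructor
  · intro H ω hω ω' hω' hg
    by_contra hne
    set P := p.map (fun ω => (f ω, g ω)) with hP
    have hpos : ∀ τ ∈ p.support, 0 < (P (f τ, g τ)).toReal := by
      intro τ hτ
      refine ENNReal.toReal_pos ?_ (P.apply_ne_top _)
      rw [← PMF.mem_support_iff, hP, PMF.mem_support_map_iff]
      exact ⟨τ, hτ, rfl⟩
    -- Two values of `f` over one value of `g` split its mass into positive parts, so one entropy
    -- term is strictly positive.
    have hadd : P (f ω, g ω) + P (f ω', g ω') ≤ p.map g (g ω) := by
      rw [hP, map_apply_eq_toOuterMeasure, map_apply_eq_toOuterMeasure,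
        map_apply_eq_toOuterMeasure, PMF.toOuterMeasure_apply, PMF.toOuterMeasure_apply,
        PMF.toOuterMeasure_apply, ← ENNReal.tsum_add]
      refine ENNReal.tsum_le_tsum fun τ => ?_
      by_cases h1 : f τ = f ω ∧ g τ = g ω
      · have h2 : ¬ (f τ = f ω' ∧ g τ = g ω') := fun h => hne (h1.1.symm.trans h.1)
        simp [Set.indicator, h1, ← hg, hne]
      · by_cases h2 : f τ = f ω' ∧ g τ = g ω'
        · simp [Set.indicator, h2, ← hg, Ne.symm hne]
        · simp [Set.indicator, h1, h2]
    have hadd' := ENNReal.toReal_mono (PMF.apply_ne_top _ _) hadd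
    rw [ENNReal.toReal_add (PMF.apply_ne_top _ _) (PMF.apply_ne_top _ _)] at hadd'
    have h1 := hpos ω hω
    have h2 := hpos ω' hω'
    refine absurd (H (g ω) (f ω)) (not_le.2 (mul_pos h1 (Real.logb_pos (by norm_num) ?_)))
    rw [lt_div_iff₀ h1]
    linarith
  · intro H b a
    rcases eq_or_ne (p.map (fun ω => (f ω, g ω)) (a, b)) 0 with h0 | h0
    · simp [h0]
    · rw [← PMF.mem_support_iff, PMF.mem_support_map_iff] at h0
      obtain ⟨ω, hω, hab⟩ := h0
      obtain ⟨rfl, rfl⟩ := Prod.mk.inj hab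
      have : p.map (fun ω => (f ω, g ω)) (f ω, g ω) = p.map g (g ω) := by
        rw [map_apply_eq_toOuterMeasure, map_apply_eq_toOuterMeasure]
        refine PMF.toOuterMeasure_apply_eq_of_inter_support_eq p ?_
        ext τ
        simp only [Set.mem_inter_iff, Set.mem_ofPred_eq, Prod.mk.injEq]
        exact ⟨fun h => ⟨h.1.2, h.2⟩, fun h => ⟨⟨H τ h.2 ω hω h.1, h.1⟩, h.2⟩⟩
      rw [this]
      rcases eq_or_ne (p.map g (g ω)).toReal 0 with h | h
      · rw [h, zero_mul]
      · rw [div_self h, Real.logb_one, mul_zero]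

end Entropy

namespace Protocol

theorem finrank_mul_logb_card {F E : Type} [Field F] [Fintype F] [Field E] [Fintype E]
    [Algebra F E] :
    Module.finrank F E * Real.logb 2 (Fintype.card F) = Real.logb 2 (Fintype.card E) := by
  rw [Module.card_eq_pow_finrank (K := F) (V := E)]
  push_cast
  rw [Real.logb_pow]

theorem logb_card_pos {E : Type} [Field E] [Fintype E] : 0 < Real.logb 2 (Fintype.card E) :=
  Real.logb_pos (by norm_num) (by exact_mod_cast Fintype.one_lt_card)

theorem ofReal_div_ofReal_mul_eq {K M : ℕ} (h : M < K) {L : ℝ} (hL : 0 < L) :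
    ENNReal.ofReal L / ENNReal.ofReal (((K - M : ℕ) : ℝ) * L) =
      ENNReal.ofReal (((K : ℝ) - (M : ℝ))⁻¹) := by
  have hKM : (0 : ℝ) < ((K - M : ℕ) : ℝ) := by exact_mod_cast Nat.sub_pos_of_lt h
  rw [← ENNReal.ofReal_div_of_pos (mul_pos hKM hL), ← Nat.cast_sub h.le]
  congr 1
  field_simp

/-! ### Marginals of the joint law and the converse bound -/

section Converse

variable {K M : ℕ} {F E : Type} [Field F] [Fintype F] [DecidableEq F] [Field E] [Fintype E]
  {𝒬 𝒜 : Type}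

theorem mem_support_law_iff (h : M < K) (P : Protocol K M F E 𝒬 𝒜) (ω : Outcome K M F E 𝒬) :
    ω ∈ (P.law h).support ↔ ω.W ∉ ω.S.1 ∧ P.query ω.W ω.S ω.C ω.Q ≠ 0 := by
  obtain ⟨W, S, C, Q, X⟩ := ω
  rw [← PMF.mem_support_iff]
  simp only [law, PMF.mem_support_bind_iff, PMF.mem_support_pure_iff,
    PMF.mem_support_uniformOfFinset_iff, Finset.mem_compl, PMF.mem_support_uniformOfFintype,
    true_and, Outcome.mk.injEq]
  constructor
  · rintro ⟨S, C, W, hW, Q, hQ, X, rfl, rfl, rfl, rfl, rfl⟩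
    exact ⟨hW, hQ⟩
  · rintro ⟨hW, hQ⟩
    exact ⟨S, C, W, hW, Q, hQ, X, rfl, rfl, rfl, rfl, rfl⟩

/-- The messages have full support independently of the rest, so zero conditional entropy becomes a
statement about all pairs `X`, `X'`, free of probability. -/
theorem isRecoverable_iff [Algebra F E] (h : M < K) (P : Protocol K M F E 𝒬 𝒜) :
    P.IsRecoverable h ↔ ∀ (W : Fin K) (S : Supp K M) (C : Coeff M F) (q : 𝒬), W ∉ S.1 →
      P.query W S C q ≠ 0 → ∀ X X' : Fin K → E, P.answer q X = P.answer q X' →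
      sideInfo S C X = sideInfo S C X' → X W = X' W := by
  rw [IsRecoverable, condEntropy_eq_zero_iff]
  simp only [mem_support_law_iff]
  constructor
  · intro H W S C q hW hq X X' hA hY
    exact H ⟨W, S, C, q, X⟩ ⟨hW, hq⟩ ⟨W, S, C, q, X'⟩ ⟨hW, hq⟩ (by simp [ans, hA, hY])
  · rintro H ⟨W, S, C, q, X⟩ ⟨hW, hq⟩ ⟨W', S', C', q', X'⟩ - hg
    simp only [ans, Prod.mk.injEq] at hg
    obtain ⟨hA, rfl, hY, rfl, rfl, rfl⟩ := hg
    exact H W S C q hW hq X X' hA hY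

/-- The joint law of demand index and support. -/
noncomputable def demandLaw (h : M < K) : PMF (Fin K × Supp K M) :=
  haveI := nonempty_supp h
  (PMF.uniformOfFintype (Supp K M)).bind fun S =>
  (PMF.uniformOfFinset (S.1ᶜ) (nonempty_compl h S)).bind fun W => PMF.pure (W, S)

theorem mem_support_demandLaw_iff (h : M < K) (w : Fin K) (s : Supp K M) :
    (w, s) ∈ (demandLaw h).support ↔ w ∉ s.1 := by
  simp only [demandLaw, PMF.mem_support_bind_iff, PMF.mem_support_pure_iff,
    PMF.mem_support_uniformOfFinset_iff, Finset.mem_compl, PMF.mem_support_uniformOfFintype,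
    true_and, Prod.mk.injEq]
  constructor
  · rintro ⟨S, W, hW, rfl, rfl⟩
    exact hW
  · intro hW
    exact ⟨s, w, hW, rfl, rfl⟩

/-- The law of the query given the demand index and the support. -/
noncomputable def queryLaw (P : Protocol K M F E 𝒬 𝒜) (x : Fin K × Supp K M) : PMF 𝒬 :=
  (PMF.uniformOfFintype (Coeff M F)).bind fun C => P.query x.1 x.2 C

theorem map_demand_law (h : M < K) (P : Protocol K M F E 𝒬 𝒜) :
    (P.law h).map (fun ω => (ω.W, ω.S)) = demandLaw h := by
  simp only [law, demandLaw, PMF.map_bind, PMF.pure_map, PMF.bind_const]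

theorem map_demand_query_law (h : M < K) (P : Protocol K M F E 𝒬 𝒜) :
    (P.law h).map (fun ω => ((ω.W, ω.S), ω.Q)) =
      (demandLaw h).bind fun x => (P.queryLaw x).map fun q => (x, q) := by
  simp only [law, demandLaw, queryLaw, PMF.map_bind, PMF.pure_map, PMF.bind_const, PMF.bind_bind,
    PMF.pure_bind]
  congr 1
  funext S
  rw [PMF.bind_comm]
  rfl

theorem map_demand_query_law_apply (h : M < K) (P : Protocol K M F E 𝒬 𝒜)
    (x : Fin K × Supp K M) (q : 𝒬) :
    (P.law h).map (fun ω => ((ω.W, ω.S), ω.Q)) (x, q) = demandLaw h x * P.queryLaw x q := by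
  classical
  rw [map_demand_query_law, PMF.bind_apply, tsum_eq_single x]
  · rw [PMF.map_apply, tsum_eq_single q]
    · simp
    · intro q' hq'
      simp [Ne.symm hq']
  · intro y hy
    rw [PMF.map_apply]
    simp [Ne.symm hy]

theorem map_query_law (h : M < K) (P : Protocol K M F E 𝒬 𝒜) :
    (P.law h).map Outcome.Q = (demandLaw h).bind P.queryLaw := by
  have := congrArg (PMF.map Prod.snd) (map_demand_query_law h P)
  simp only [PMF.map_comp, PMF.map_bind, Function.comp_def] at this
  exact this.trans (congrArg _ (funext fun x => PMF.map_id _))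

theorem map_ans_law (h : M < K) (P : Protocol K M F E 𝒬 𝒜) :
    (P.law h).map P.ans = ((P.law h).map Outcome.Q).bind fun q =>
      (PMF.uniformOfFintype (Fin K → E)).map (P.answer q) := by
  simp only [law, PMF.map_bind, PMF.pure_map, PMF.bind_const, PMF.bind_bind, PMF.pure_bind, ans]
  rfl

/-- A protocol is private if the law of the query is the same for all demands. -/
theorem isPrivate_of_queryLaw_eq (h : M < K) (P : Protocol K M F E 𝒬 𝒜) (ν : PMF 𝒬)
    (hν : ∀ (w : Fin K) (s : Supp K M), w ∉ s.1 → P.queryLaw (w, s) = ν) : P.IsPrivate h := by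
  have hmul : ∀ x q, demandLaw h x * P.queryLaw x q = demandLaw h x * ν q := by
    rintro ⟨w, s⟩ q
    by_cases hw : w ∈ s.1
    · rw [(PMF.apply_eq_zero_iff _ _).2 (by rw [mem_support_demandLaw_iff]; exact not_not.2 hw),
        zero_mul, zero_mul]
    · rw [hν w s hw]
  have hQ : (P.law h).map Outcome.Q = ν := by
    ext q
    rw [map_query_law, PMF.bind_apply]
    simp only [hmul]
    rw [ENNReal.tsum_mul_right, PMF.tsum_coe, one_mul]
  intro q hq w s
  rw [hQ] at hq ⊢
  rw [map_demand_query_law_apply, map_demand_law, hmul,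
    ENNReal.mul_div_cancel_right hq (ν.apply_ne_top q)]

/-- Every occurring query of a private protocol occurs for all demands. -/
theorem IsPrivate.exists_coeff {h : M < K} {P : Protocol K M F E 𝒬 𝒜} (hP : P.IsPrivate h)
    {q : 𝒬} (hq : (P.law h).map Outcome.Q q ≠ 0) {w : Fin K} {s : Supp K M} (hw : w ∉ s.1) :
    ∃ C, P.query w s C q ≠ 0 := by
  have h1 := hP q hq w s
  rw [map_demand_query_law_apply, map_demand_law] at h1
  have h2 : demandLaw h (w, s) ≠ 0 :=
    (PMF.mem_support_iff _ _).1 ((mem_support_demandLaw_iff h w s).2 hw)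
  have h3 : P.queryLaw (w, s) q ≠ 0 := by
    intro h0
    rw [h0, mul_zero, ENNReal.zero_div] at h1
    exact h2 h1.symm
  rw [← PMF.mem_support_iff, queryLaw, PMF.mem_support_bind_iff] at h3
  obtain ⟨C, -, hC⟩ := h3
  exact ⟨C, hC⟩

/-- Restriction to a fixed support `s` is injective on the fibre. The coefficients `C` supplied by
privacy may vary with `w`, which is harmless: agreement on `s` equates the side information for
every `C`. -/
theorem card_answer_fiber_le [Algebra F E] [DecidableEq 𝒜] {h : M < K}
    {P : Protocol K M F E 𝒬 𝒜} (hP : P.IsPrivate h) (hR : P.IsRecoverable h)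
    {q : 𝒬} (hq : (P.law h).map Outcome.Q q ≠ 0) (a : 𝒜) :
    (Finset.univ.filter fun X : Fin K → E => P.answer q X = a).card ≤ Fintype.card E ^ M := by
  obtain ⟨s⟩ := nonempty_supp h
  rw [isRecoverable_iff] at hR
  have hcard : Fintype.card E ^ M = (Finset.univ : Finset (s.1 → E)).card := by
    rw [Finset.card_univ, Fintype.card_fun, Fintype.card_coe, s.2]
  rw [hcard]
  refine Finset.card_le_card_of_injOn (fun X i => X i) (fun _ _ => Finset.mem_coe.2
    (Finset.mem_univ _)) ?_
  intro X hX X' hX' hXX'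
  have hX : P.answer q X = a := by simpa using hX
  have hX' : P.answer q X' = a := by simpa using hX'
  have hs : ∀ i ∈ s.1, X i = X' i := fun i hi => congrFun hXX' ⟨i, hi⟩
  funext w
  by_cases hw : w ∈ s.1
  · exact hs w hw
  · obtain ⟨C, hC⟩ := hP.exists_coeff hq hw
    refine hR w s C q hw hC X X' (hX.trans hX'.symm) ?_
    refine Finset.sum_congr rfl fun k _ => ?_
    rw [hs _ (Finset.orderEmbOfFin_mem s.1 s.2 k)]

/-- The fibre bound is uniform over the occurring queries, so it survives averaging over them and
bounds the unconditional law of the answer. -/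
theorem map_ans_law_apply_le [Algebra F E] {h : M < K} {P : Protocol K M F E 𝒬 𝒜}
    (hP : P.IsPrivate h) (hR : P.IsRecoverable h) (a : 𝒜) :
    ((P.law h).map P.ans a).toReal ≤ ((Fintype.card E : ℝ) ^ (K - M))⁻¹ := by
  classical
  have hE : (0 : ℝ) < Fintype.card E := by exact_mod_cast Fintype.card_pos
  refine ENNReal.toReal_le_of_le_ofReal (by positivity) ?_
  have hfib : ∀ q, (P.law h).map Outcome.Q q ≠ 0 →
      (PMF.uniformOfFintype (Fin K → E)).map (P.answer q) a ≤
        ENNReal.ofReal ((Fintype.card E : ℝ) ^ (K - M))⁻¹ := by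
    intro q hq
    have h1 : (PMF.uniformOfFintype (Fin K → E)).map (P.answer q) a =
        ((Finset.univ.filter fun X : Fin K → E => P.answer q X = a).card : ℝ≥0∞) *
          ((Fintype.card E ^ K : ℕ) : ℝ≥0∞)⁻¹ := by
      rw [PMF.map_apply, tsum_fintype, Finset.card_filter]
      simp only [PMF.uniformOfFintype_apply, Fintype.card_fun, Fintype.card_fin, eq_comm (a := a)]
      push_cast
      rw [Finset.sum_mul]
      refine Finset.sum_congr rfl fun X _ => ?_
      split_ifs <;> simp
    have h2 : (((Finset.univ.filter fun X : Fin K → E => P.answer q X = a).card : ℕ) : ℝ) *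
        (((Fintype.card E ^ K : ℕ) : ℝ))⁻¹ ≤ ((Fintype.card E : ℝ) ^ (K - M))⁻¹ := by
      have h3 : (((Finset.univ.filter fun X : Fin K → E => P.answer q X = a).card : ℕ) : ℝ) ≤
          (Fintype.card E : ℝ) ^ M := by exact_mod_cast card_answer_fiber_le hP hR hq a
      have h4 : (Fintype.card E : ℝ) ^ K =
          (Fintype.card E : ℝ) ^ M * (Fintype.card E : ℝ) ^ (K - M) := by
        rw [← pow_add, Nat.add_sub_cancel' h.le]
      push_cast
      rw [h4, mul_inv, ← mul_assoc]
      refine mul_le_of_le_one_left (by positivity) ?_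
      rw [← div_eq_mul_inv]
      exact (div_le_one (by positivity)).2 h3
    rw [h1]
    refine le_trans (le_of_eq ?_) (ENNReal.ofReal_le_ofReal h2)
    rw [ENNReal.ofReal_mul (by positivity), ENNReal.ofReal_natCast,
      ENNReal.ofReal_inv_of_pos (by push_cast; positivity), ENNReal.ofReal_natCast]
  rw [map_ans_law, PMF.bind_apply]
  refine (ENNReal.tsum_le_tsum fun q => ?_).trans_eq (by
    rw [ENNReal.tsum_mul_right, PMF.tsum_coe, one_mul] :
    ∑' q, (P.law h).map Outcome.Q q * ENNReal.ofReal ((Fintype.card E : ℝ) ^ (K - M))⁻¹ = _)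
  rcases eq_or_ne ((P.law h).map Outcome.Q q) 0 with h0 | h0
  · rw [h0, zero_mul, zero_mul]
  · gcongr
    exact hfib q h0

/-- The converse bound. -/
theorem rate_le [Algebra F E] {h : M < K} {P : Protocol K M F E 𝒬 𝒜}
    (hP : P.IsPrivate h) (hR : P.IsRecoverable h) :
    P.rate h ≤ ENNReal.ofReal (((K : ℝ) - (M : ℝ))⁻¹) := by
  have hE : (0 : ℝ) < Fintype.card E := by exact_mod_cast Fintype.card_pos
  rw [rate, finrank_mul_logb_card, ← ofReal_div_ofReal_mul_eq h (logb_card_pos (E := E)),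
    ← Real.logb_pow]
  gcongr
  exact logb_le_entropy _ _ (by positivity) (map_ans_law_apply_le hP hR)

end Converse

/-! ### Achievability by generalized Reed-Solomon codes -/

section ReedSolomon

variable {K M : ℕ} {F : Type} [Field F]

/-- The polynomial that vanishes at the evaluation points of the indices outside `S ∪ {w}`. -/
noncomputable def locator (x : Fin K → F) (w : Fin K) (S : Finset (Fin K)) : Polynomial F :=
  ∏ i ∈ (insert w S)ᶜ, (Polynomial.X - Polynomial.C (x i))

theorem locator_eval_eq_zero_iff {x : Fin K → F} (hx : Function.Injective x) (w : Fin K)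
    (S : Finset (Fin K)) (j : Fin K) : (locator x w S).eval (x j) = 0 ↔ j ∉ insert w S := by
  simp only [locator, Polynomial.eval_prod, Polynomial.eval_sub, Polynomial.eval_X,
    Polynomial.eval_C, Finset.prod_eq_zero_iff, Finset.mem_compl, sub_eq_zero]
  exact ⟨fun ⟨i, hi, hij⟩ => hx hij ▸ hi, fun hj => ⟨j, hj, rfl⟩⟩

/-- There are `K - M - 1` roots, so the `K - M` coefficients match the `K - M` checks in the answer.
-/
theorem natDegree_locator_lt (h : M < K) (x : Fin K → F) {w : Fin K} {S : Supp K M}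
    (hw : w ∉ S.1) : (locator x w S.1).natDegree < K - M := by
  rw [locator, Polynomial.natDegree_prod_of_monic _ _ fun i _ => Polynomial.monic_X_sub_C _]
  simp only [Polynomial.natDegree_X_sub_C, Finset.sum_const, smul_eq_mul, mul_one]
  rw [Finset.card_compl, Finset.card_insert_of_notMem hw, Fintype.card_fin, S.2]
  omega

open scoped Classical in
/-- The value of the locator polynomial at `x i`, for `i` in `S ∪ {w}`. -/
noncomputable def locatorValue (x : Fin K → F) (w : Fin K) (S : Finset (Fin K)) (i : Fin K) : Fˣ :=
  -- The default `1` is never reached on `S ∪ {w}` for injective `x`; it keeps the multipliers units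
  -- for every `x`.
  if he : (locator x w S).eval (x i) = 0 then 1 else Units.mk0 _ he

/-- The column multipliers of the generalized Reed-Solomon code whose codeword with support
`S ∪ {w}` has the entries `C` on `S`; they are given by `u` outside of `S`. -/
noncomputable def multiplier (x : Fin K → F) (w : Fin K) (S : Supp K M) (C : Coeff M F)
    (u : {i // i ∉ S.1} → Fˣ) (i : Fin K) : Fˣ :=
  if hi : i ∈ S.1 then
    C ((S.1.orderIsoOfFin S.2).symm ⟨i, hi⟩) * (locatorValue x w S.1 i)⁻¹
  else u ⟨i, hi⟩

theorem multiplier_orderEmbOfFin_mul {x : Fin K → F} (hx : Function.Injective x) (w : Fin K)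
    (S : Supp K M) (C : Coeff M F) (u : {i // i ∉ S.1} → Fˣ) (k : Fin M) :
    (multiplier x w S C u (S.1.orderEmbOfFin S.2 k) : F) *
      (locator x w S.1).eval (x (S.1.orderEmbOfFin S.2 k)) = C k := by
  have hi : S.1.orderEmbOfFin S.2 k ∈ S.1 := Finset.orderEmbOfFin_mem S.1 S.2 k
  have he : (locator x w S.1).eval (x (S.1.orderEmbOfFin S.2 k)) ≠ 0 := by
    rw [Ne, locator_eval_eq_zero_iff hx, not_not]
    exact Finset.mem_insert_of_mem hi
  have hk : (S.1.orderIsoOfFin S.2).symm ⟨S.1.orderEmbOfFin S.2 k, hi⟩ = k := by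
    rw [OrderIso.symm_apply_eq]
    rfl
  rw [multiplier, dif_pos hi, locatorValue, dif_neg he, hk]
  simp [he]

/-- On `S` the map rescales the entries of `C` by fixed units; off `S` it copies `u`. -/
theorem multiplier_bijective (x : Fin K → F) (w : Fin K) (S : Supp K M) :
    Function.Bijective fun z : Coeff M F × ({i // i ∉ S.1} → Fˣ) => multiplier x w S z.1 z.2 := by
  refine ⟨fun ⟨C, u⟩ ⟨C', u'⟩ hz => ?_, fun v => ?_⟩
  · refine Prod.ext (funext fun k => ?_) (funext fun i => ?_)
    · have := congrFun hz (S.1.orderIsoOfFin S.2 k)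
      simp only [multiplier, dif_pos (S.1.orderIsoOfFin S.2 k).2, Subtype.coe_eta,
        OrderIso.symm_apply_apply] at this
      exact mul_right_cancel this
    · have := congrFun hz i
      simpa [multiplier, i.2] using this
  · refine ⟨(fun k => v (S.1.orderIsoOfFin S.2 k) *
      locatorValue x w S.1 (S.1.orderIsoOfFin S.2 k), fun i => v i), funext fun i => ?_⟩
    by_cases hi : i ∈ S.1
    · simp only [multiplier, hi, dif_pos, OrderIso.apply_symm_apply, mul_inv_cancel_right]
    · simp only [multiplier, hi, dif_neg, not_false_eq_true]

/-- Decoding identity: after exchanging sums, `X j` has coefficient `v j` times the locator value at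
`x j`. This vanishes off `S ∪ {w}` and equals the entry of `C` on `S`. -/
theorem sum_locator_mul {x : Fin K → F} (hx : Function.Injective x) (h : M < K) {w : Fin K}
    {S : Supp K M} (hw : w ∉ S.1) (C : Coeff M F) (u : {i // i ∉ S.1} → Fˣ) (X : Fin K → F) :
    ∑ m : Fin (K - M), (locator x w S.1).coeff m *
        ∑ j, ((multiplier x w S C u j : F) * x j ^ (m : ℕ)) • X j =
      multiplier x w S C u w * (locator x w S.1).eval (x w) * X w + sideInfo S C X := by
  have h1 : ∑ m : Fin (K - M), (locator x w S.1).coeff m *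
        ∑ j, ((multiplier x w S C u j : F) * x j ^ (m : ℕ)) • X j =
      ∑ j, multiplier x w S C u j * (locator x w S.1).eval (x j) * X j := by
    simp only [Finset.mul_sum, smul_eq_mul]
    rw [Finset.sum_comm]
    refine Finset.sum_congr rfl fun j _ => ?_
    rw [Polynomial.eval_eq_sum_range' (natDegree_locator_lt h x hw), Finset.mul_sum,
      Finset.sum_mul, ← Fin.sum_univ_eq_sum_range fun m =>
        (multiplier x w S C u j : F) * ((locator x w S.1).coeff m * x j ^ m) * X j]
    exact Finset.sum_congr rfl fun m _ => by ring
  rw [h1, ← Finset.sum_subset (Finset.subset_univ (insert w S.1)) fun j _ hj => by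
    rw [(locator_eval_eq_zero_iff hx w S.1 j).2 hj, mul_zero, zero_mul],
    Finset.sum_insert hw, sideInfo]
  congr 1
  have himage : Finset.univ.image (S.1.orderEmbOfFin S.2) = S.1 :=
    Finset.image_orderEmbOfFin_univ S.1 S.2
  rw [← Finset.sum_congr himage fun _ _ => rfl,
    Finset.sum_image fun _ _ _ _ hab => (S.1.orderEmbOfFin S.2).injective hab]
  refine Finset.sum_congr rfl fun k _ => ?_
  rw [multiplier_orderEmbOfFin_mul hx, smul_eq_mul]

variable [Fintype F] [DecidableEq F]

/-- The protocol that asks for the combinations `∑ⱼ vⱼ xⱼᵐ Xⱼ`, `m < K - M`. -/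
noncomputable def reedSolomon (x : Fin K → F) : Protocol K M F F (Fin K → Fˣ) (List F) where
  query w S C := (PMF.uniformOfFintype ({i // i ∉ S.1} → Fˣ)).map (multiplier x w S C)
  answer v X := List.ofFn fun m : Fin (K - M) => ∑ j, ((v j : F) * x j ^ (m : ℕ)) • X j

theorem reedSolomon_isScalarLinear (x : Fin K → F) :
    (reedSolomon x : Protocol K M F F _ _).IsScalarLinear := fun v =>
  ⟨K - M, fun m j => (v j : F) * x j ^ (m : ℕ), fun _ => rfl⟩

/-- Averaged over `C`, the query is the image of a uniform pair `(C, u)` under a bijection. -/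
theorem reedSolomon_queryLaw_eq (x : Fin K → F) (w : Fin K) (S : Supp K M) :
    (reedSolomon x : Protocol K M F F _ _).queryLaw (w, S) = PMF.uniformOfFintype _ := by
  classical
  ext v
  obtain ⟨⟨C, u⟩, rfl⟩ := (multiplier_bijective x w S).2 v
  have hcard := Fintype.card_of_bijective (multiplier_bijective x w S)
  rw [Fintype.card_prod] at hcard
  have hiff : ∀ (C' : Coeff M F) (u' : {i // i ∉ S.1} → Fˣ),
      multiplier x w S C u = multiplier x w S C' u' ↔ C' = C ∧ u' = u := by
    intro C' u'
    rw [eq_comm]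
    exact ((multiplier_bijective x w S).1.eq_iff (a := (C', u')) (b := (C, u))).trans
      Prod.mk_inj
  simp only [queryLaw, reedSolomon, PMF.bind_apply, PMF.map_apply, PMF.uniformOfFintype_apply,
    hiff]
  rw [tsum_eq_single C fun C' hC' => by simp [hC'], tsum_eq_single u fun u' hu' => by simp [hu']]
  rw [if_pos ⟨rfl, rfl⟩, ← hcard, Nat.cast_mul, ENNReal.mul_inv (Or.inr (ENNReal.natCast_ne_top _))
    (Or.inl (ENNReal.natCast_ne_top _))]

theorem reedSolomon_isPrivate (h : M < K) (x : Fin K → F) :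
    (reedSolomon x : Protocol K M F F _ _).IsPrivate h :=
  isPrivate_of_queryLaw_eq h _ _ fun w s _ => reedSolomon_queryLaw_eq x w s

theorem reedSolomon_isRecoverable (h : M < K) {x : Fin K → F} (hx : Function.Injective x) :
    (reedSolomon x : Protocol K M F F _ _).IsRecoverable h := by
  rw [isRecoverable_iff]
  intro w S C v hw hv X X' hA hY
  rw [← PMF.mem_support_iff, reedSolomon, PMF.mem_support_map_iff] at hv
  obtain ⟨u, -, rfl⟩ := hv
  have hA' := List.ofFn_injective hA
  have h1 := sum_locator_mul hx h hw C u X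
  have h2 := sum_locator_mul hx h hw C u X'
  have h3 : ∑ m : Fin (K - M), (locator x w S.1).coeff m *
        ∑ j, ((multiplier x w S C u j : F) * x j ^ (m : ℕ)) • X j =
      ∑ m : Fin (K - M), (locator x w S.1).coeff m *
        ∑ j, ((multiplier x w S C u j : F) * x j ^ (m : ℕ)) • X' j :=
    Finset.sum_congr rfl fun m _ => congrArg _ (congrFun hA' m)
  rw [h1, h2, hY] at h3
  -- The demand can be isolated because its coefficient is a unit times the locator value at `x w`,
  -- which is not a root.
  refine mul_left_cancel₀ (mul_ne_zero (Units.ne_zero _) ?_) (add_right_cancel h3)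
  rw [Ne, locator_eval_eq_zero_iff hx, not_not]
  exact Finset.mem_insert_self _ _

/-- The answer takes at most `|F| ^ (K - M)` values, which bounds its entropy from above. -/
theorem le_reedSolomon_rate (h : M < K) (x : Fin K → F) :
    ENNReal.ofReal (((K : ℝ) - (M : ℝ))⁻¹) ≤ (reedSolomon x : Protocol K M F F _ _).rate h := by
  classical
  rw [rate, finrank_mul_logb_card, ← ofReal_div_ofReal_mul_eq h (logb_card_pos (E := F))]
  gcongr
  have := entropy_le_logb_card (((reedSolomon x : Protocol K M F F _ _).law h).map
    (reedSolomon x : Protocol K M F F _ _).ans)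
    (Finset.univ.image fun a : Fin (K - M) → F => List.ofFn a) fun a ha => ?_
  · rwa [Finset.card_image_of_injective _ List.ofFn_injective, Finset.card_univ, Fintype.card_fun,
      Fintype.card_fin, Nat.cast_pow, Real.logb_pow] at this
  · rw [PMF.apply_eq_zero_iff, PMF.mem_support_map_iff]
    rintro ⟨ω, -, rfl⟩
    exact ha (Finset.mem_image_of_mem _ (Finset.mem_univ _))

end ReedSolomon

end Protocol

/-! ### Both capacities -/

theorem capacity_le (K M : ℕ) (h : M < K) :
    capacity K M h ≤ ENNReal.ofReal (((K : ℝ) - (M : ℝ))⁻¹) := by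
  refine sSup_le ?_
  rintro r ⟨F, E, _, _, _, _, _, _, 𝒬, 𝒜, P, hP, hR, rfl⟩
  exact Protocol.rate_le hP hR

theorem scalarLinearCapacity_le_capacity (K M : ℕ) (h : M < K) :
    scalarLinearCapacity K M h ≤ capacity K M h := by
  refine sSup_le_sSup ?_
  rintro r ⟨F, E, i1, i2, i3, i4, i5, i6, 𝒬, P, -, hP, hR, rfl⟩
  exact ⟨F, E, i1, i2, i3, i4, i5, i6, 𝒬, List E, P, hP, hR, rfl⟩

theorem le_scalarLinearCapacity (K M : ℕ) (h : M < K) :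
    ENNReal.ofReal (((K : ℝ) - (M : ℝ))⁻¹) ≤ scalarLinearCapacity K M h := by
  -- A prime `p ≥ K` gives `K` distinct evaluation points in `ZMod p`; the trivial extension
  -- suffices.
  obtain ⟨p, hKp, hp⟩ := Nat.exists_infinite_primes K
  have : Fact p.Prime := ⟨hp⟩
  obtain ⟨x⟩ : Nonempty (Fin K ↪ ZMod p) :=
    Function.Embedding.nonempty_of_card_le (by rwa [Fintype.card_fin, ZMod.card])
  refine (Protocol.le_reedSolomon_rate h x).trans (le_sSup ?_)
  exact ⟨ZMod p, ZMod p, inferInstance, inferInstance, inferInstance, inferInstance, inferInstance,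
    inferInstance, _, Protocol.reedSolomon x, Protocol.reedSolomon_isScalarLinear x,
    Protocol.reedSolomon_isPrivate h x, Protocol.reedSolomon_isRecoverable h x.injective, rfl⟩

end PIR

theorem theorem1 (K M : ℕ) (hM : 1 ≤ M) (hMK : M < K) :
    PIR.capacity K M hMK = ENNReal.ofReal (((K : ℝ) - (M : ℝ))⁻¹) ∧
      PIR.scalarLinearCapacity K M hMK = ENNReal.ofReal (((K : ℝ) - (M : ℝ))⁻¹) := by
  have h1 := PIR.capacity_le K M hMK
  have h2 := PIR.scalarLinearCapacity_le_capacity K M hMK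
  have h3 := PIR.le_scalarLinearCapacity K M hMK
  exact ⟨le_antisymm h1 (h3.trans h2), le_antisymm (h2.trans h1) h3⟩
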